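/- All graphs are finite, undirected and simple. For a graph $G$, let $n_o(G)$ denote the number of vertices of odd degree in $G$. A path decomposition of $G$ is a collection of pairwise edge-disjoint paths of $G$ that covers all the edges of $G$, and $p(G)$ denotes the minimum number of paths in a path decomposition of $G$. Let $P_m$ be the path with $m$ vertices, and let $G\,\Box\,H$ be the Cartesian product of $G$ and $H$, that is, the graph with vertex set $V(G)\times V(H)$ in which $(u_1,v_1)$ and $(u_2,v_2)$ are adjacent if and only if either $u_1u_2\in E(G)$ and $v_1=v_2$, or $v_1v_2\in E(H)$ and $u_1=u_2$. **Theorem 5.3.** Let $H$ be a graph (not necessarily connected) with $n$ vertices in which every vertex has even degree. Then for every integer $m\ge 2$, $$p(P_m\,\Box\,H)=\frac{n_o(P_m\,\Box\,H)}{2}=n.$$ -/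

import Mathlib

namespace SimpleGraph

variable {V : Type*}

/-- A subgraph of `G` is a path of `G` if it consists of the vertices and edges traversed by a walk
without repeated vertices. -/
def Subgraph.IsPathSubgraph {G : SimpleGraph V} (P : G.Subgraph) : Prop :=
  ∃ (u v : V) (w : G.Walk u v), w.IsPath ∧ P = w.toSubgraph

/-- A path decomposition of `G`: a finite collection of pairwise edge-disjoint paths of `G` that
together cover all the edges of `G`. -/
structure IsPathDecomposition (G : SimpleGraph V) (D : Finset G.Subgraph) : Prop where
  isPath : ∀ P ∈ D, P.IsPathSubgraph
  edgeDisjoint : ∀ P ∈ D, ∀ Q ∈ D, P ≠ Q → Disjoint P.edgeSet Q.edgeSet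
  covers : ∀ e ∈ G.edgeSet, ∃ P ∈ D, e ∈ P.edgeSet

/-- The path number `p(G)`: the least number of paths in a path decomposition of `G`. (For finite
`G` the minimum is attained, see `exists_isPathDecomposition_card_eq_pathNumber`.) -/
noncomputable def pathNumber (G : SimpleGraph V) : ℕ :=
  sInf {k : ℕ | ∃ D : Finset G.Subgraph, G.IsPathDecomposition D ∧ D.card = k}

open Classical in
/-- The number `n_o(G)` of vertices of odd degree of a finite graph `G`. -/
noncomputable def numOddVertices [Fintype V] (G : SimpleGraph V) : ℕ :=
  (Finset.univ.filter fun v : V => Odd (G.degree v)).card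

/-- A finite graph has a path decomposition: take its single edges. -/
theorem exists_isPathDecomposition [Finite V] (G : SimpleGraph V) :
    ∃ D : Finset G.Subgraph, G.IsPathDecomposition D := by
  classical
  have key : ∀ e ∈ G.edgeSet, ∃ P : G.Subgraph, P.IsPathSubgraph ∧ P.edgeSet = {e} := by
    intro e
    induction e using Sym2.ind with
    | _ u v =>
      intro h
      have h' : G.Adj u v := h
      exact ⟨G.subgraphOfAdj h',
        ⟨u, v, h'.toWalk, Walk.IsPath.of_adj h', by
          simp [Walk.toSubgraph]⟩, by simp⟩
  choose! f hf1 hf2 using key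
  have hfin : G.edgeSet.Finite := Set.toFinite _
  refine ⟨hfin.toFinset.image f, ?_, ?_, ?_⟩
  · intro P hP
    simp only [Finset.mem_image, Set.Finite.mem_toFinset] at hP
    obtain ⟨e, he, rfl⟩ := hP
    exact hf1 e he
  · intro P hP Q hQ hne
    simp only [Finset.mem_image, Set.Finite.mem_toFinset] at hP hQ
    obtain ⟨e, he, rfl⟩ := hP
    obtain ⟨e', he', rfl⟩ := hQ
    rw [hf2 e he, hf2 e' he', Set.disjoint_singleton]
    rintro rfl
    exact hne rfl
  · intro e he
    refine ⟨f e, ?_, ?_⟩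
    · simp only [Finset.mem_image, Set.Finite.mem_toFinset]
      exact ⟨e, he, rfl⟩
    · rw [hf2 e he]
      exact Set.mem_singleton e

/-- The minimum in the definition of the path number of a finite graph is attained. -/
theorem exists_isPathDecomposition_card_eq_pathNumber [Finite V] (G : SimpleGraph V) :
    ∃ D : Finset G.Subgraph, G.IsPathDecomposition D ∧ D.card = G.pathNumber := by
  obtain ⟨D, h⟩ := G.exists_isPathDecomposition
  exact Nat.sInf_mem (s := {k : ℕ | ∃ D : Finset G.Subgraph,
    G.IsPathDecomposition D ∧ D.card = k}) ⟨_, D, h, rfl⟩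

end SimpleGraph

/-!
An edge can be added to a partition into paths at the cost of moving one end of a path along that
edge (Lovász). Building up `H` edge by edge in this way, one splits it into paths of which every
vertex is an end exactly twice, where a path of length zero has its vertex as an end twice. Hall's
theorem then orients these paths so that exactly one starts at every vertex `v`; it ends at `σ v`
for a permutation `σ` of the vertices.

In `P_m □ H`, follow the path from `v` in the first layer, cross to the second layer at `σ v`,
follow the copy of the path from `σ v` there, and so on. As `σ` is a permutation, these `n` paths
use every edge exactly once. Conversely, every vertex of odd degree is an end of some path of a
path decomposition, and the `2n` vertices of the first and the last layer have odd degree.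
-/

namespace PathDecomposition

variable {V A : Type*}

/-- The first vertex of a list of vertices, as a multiset with at most one element, so that it is
defined for the empty list too. -/
def head (l : List V) : Multiset V := l.head?.toList

/-- The last vertex of a list of vertices, as a multiset with at most one element. -/
def last (l : List V) : Multiset V := l.getLast?.toList

/-- The two ends of the path that visits the vertices of `l` in order. A path of length zero has
its only vertex as an end twice, so every nonempty list has exactly two ends. -/
def ends (l : List V) : Multiset V := head l + last l

/-- The edges of the path that visits the vertices of `l` in order. -/
def edges (l : List V) : Multiset (Sym2 V) := List.zipWith (s(·, ·)) l l.tail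

@[simp] lemma head_nil : head ([] : List V) = 0 := by simp [head]

@[simp] lemma head_cons (a : V) (l : List V) : head (a :: l) = {a} := rfl

@[simp] lemma last_nil : last ([] : List V) = 0 := by simp [last]

@[simp] lemma last_append_cons (p l : List V) (a : V) : last (p ++ a :: l) = last (a :: l) := by
  simp [last, List.getLast?_append, List.getLast?_cons]

@[simp] lemma head_reverse (l : List V) : head l.reverse = last l := by simp [head, last]

@[simp] lemma last_reverse (l : List V) : last l.reverse = head l := by simp [head, last]

@[simp] lemma ends_reverse (l : List V) : ends l.reverse = ends l := by simp [ends, add_comm]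

lemma head_map (f : V → A) (l : List V) : head (l.map f) = (head l).map f := by
  cases l <;> rfl

lemma last_map (f : V → A) (l : List V) : last (l.map f) = (last l).map f := by
  rw [← head_reverse, ← List.map_reverse, head_map, head_reverse]

lemma eq_cons_of_mem_head {l : List V} {v : V} (h : v ∈ head l) : ∃ t, l = v :: t := by
  cases l <;> simp_all

lemma head_eq_of_mem {l : List V} {v : V} (h : v ∈ head l) : head l = {v} := by
  obtain ⟨t, rfl⟩ := eq_cons_of_mem_head h
  rfl

lemma last_eq_of_mem {l : List V} {v : V} (h : v ∈ last l) : last l = {v} := by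
  rw [← head_reverse] at h ⊢
  exact head_eq_of_mem h

lemma exists_mem_head_of_mem_last {l : List V} {v : V} (h : v ∈ last l) : ∃ u, u ∈ head l := by
  cases l with
  | nil => simp at h
  | cons u l => exact ⟨u, by simp⟩

lemma mem_of_mem_head {l : List V} {v : V} (h : v ∈ head l) : v ∈ l := by
  obtain ⟨t, rfl⟩ := eq_cons_of_mem_head h
  simp

lemma last_cons_eq_last {l : List V} (h : l ≠ []) (a : V) : last (a :: l) = last l := by
  obtain ⟨v, t, rfl⟩ := List.exists_cons_of_ne_nil h
  exact last_append_cons [a] t v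

lemma mem_last_of_mem_last_cons {l : List V} {a v : V} (hv : v ≠ a) (h : v ∈ last (a :: l)) :
    v ∈ last l := by
  cases l with
  | nil => simp [last, hv] at h
  | cons b l => rwa [last_cons_eq_last (List.cons_ne_nil b l)] at h

@[simp] lemma edges_nil : edges ([] : List V) = 0 := by simp [edges]

lemma edges_cons (a : V) (l : List V) : edges (a :: l) = (head l).map (s(a, ·)) + edges l := by
  cases l <;> rfl

lemma edges_append (p q : List V) :
    edges (p ++ q) =
      edges p + ((last p).bind fun a => (head q).map (s(a, ·))) + edges q := by
  induction p with
  | nil => simp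
  | cons a p ih =>
    rcases p with _ | ⟨b, p⟩
    · simp [edges_cons, last]
    · rw [List.cons_append, edges_cons, ih, edges_cons a, last_cons_eq_last (List.cons_ne_nil b p)]
      simp [add_assoc]

@[simp] lemma edges_reverse (l : List V) : edges l.reverse = edges l := by
  induction l with
  | nil => rfl
  | cons a l ih =>
    rw [List.reverse_cons, edges_append, ih, last_reverse, edges_cons, edges_cons]
    simp [Multiset.bind_singleton, Sym2.eq_swap, add_comm]

lemma edges_map (f : V → A) (l : List V) : edges (l.map f) = (edges l).map (Sym2.map f) := by
  induction l with
  | nil => rfl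
  | cons a l ih => simp [edges_cons, ih, head_map, Function.comp_def]

lemma mem_of_mem_edges {l : List V} {e : Sym2 V} {v : V} (he : e ∈ edges l) (hv : v ∈ e) :
    v ∈ l := by
  induction l with
  | nil => simp at he
  | cons a l ih =>
    rw [edges_cons, Multiset.mem_add, Multiset.mem_map] at he
    obtain ⟨b, hb, rfl⟩ | he := he
    · rcases Sym2.mem_iff.mp hv with rfl | rfl
      · exact List.mem_cons_self
      · exact List.mem_cons_of_mem _ (mem_of_mem_head hb)
    · exact List.mem_cons_of_mem _ (ih he)

/-- `D` is a collection of paths, given by their lists of vertices, whose edges make up `E`, each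
edge being used as often as it occurs in `E`. -/
structure IsPathPartition (D : Multiset (List V)) (E : Multiset (Sym2 V)) : Prop where
  ne_nil : ∀ l ∈ D, l ≠ []
  nodup : ∀ l ∈ D, l.Nodup
  bind_edges : D.bind edges = E

section Through

variable {a : V}

/-- The path through `a` with the two given legs, each listed from the neighbour of `a` outwards. -/
def through (a : V) (pq : List V × List V) : List V := pq.1.reverse ++ a :: pq.2

/-- The two legs of a path through a vertex, see `through`. -/
def legs (pq : List V × List V) : Multiset (List V) := {pq.1, pq.2}

lemma exists_eq_through {l : List V} (h : a ∈ l) : ∃ pq, through a pq = l := by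
  obtain ⟨p, q, rfl⟩ := List.append_of_mem h
  exact ⟨(p.reverse, q), by simp [through]⟩

lemma through_perm (a : V) (pq : List V × List V) :
    (through a pq).Perm (a :: (pq.1 ++ pq.2)) :=
  List.perm_middle.trans (((List.reverse_perm _).append_right _).cons a)

lemma notMem_of_mem_legs {pq : List V × List V} {l : List V} (h : (through a pq).Nodup)
    (hl : l ∈ legs pq) : a ∉ l := by
  have ha := (List.nodup_cons.mp ((through_perm a pq).nodup_iff.mp h)).1
  rw [List.mem_append, not_or] at ha
  simp only [legs, Multiset.insert_eq_cons, Multiset.mem_cons, Multiset.mem_singleton] at hl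
  obtain rfl | rfl := hl
  exacts [ha.1, ha.2]

lemma edges_through (a : V) (pq : List V × List V) :
    edges (through a pq) = (legs pq).bind fun l => edges (a :: l) := by
  simp only [through, legs, edges_append, edges_reverse, last_reverse, head_cons,
    Multiset.map_singleton, Multiset.bind_singleton, Multiset.insert_eq_cons,
    Multiset.cons_bind, Multiset.singleton_bind, edges_cons, Sym2.eq_swap (b := a), add_comm]

lemma ends_through (a : V) (pq : List V × List V) :
    ends (through a pq) = (legs pq).bind fun l => last (a :: l) := by
  have hhead : head (through a pq) = last (a :: pq.1) := by
    rw [← head_reverse, List.reverse_cons, through]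
    cases pq.1.reverse <;> rfl
  have hlast : last (through a pq) = last (a :: pq.2) := last_append_cons _ _ _
  simp only [ends, hhead, hlast, legs, Multiset.insert_eq_cons, Multiset.cons_bind,
    Multiset.singleton_bind]

lemma bind_edges_map_through (M : Multiset (List V × List V)) :
    (M.map (through a)).bind edges = (M.bind legs).bind fun l => edges (a :: l) := by
  simp only [Multiset.bind_map, Multiset.bind_assoc, edges_through]

lemma bind_ends_map_through (M : Multiset (List V × List V)) :
    (M.map (through a)).bind ends = (M.bind legs).bind fun l => last (a :: l) := by
  simp only [Multiset.bind_map, Multiset.bind_assoc, ends_through]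

lemma exists_eq_add_map_through (a : V) (D : Multiset (List V)) :
    ∃ (N : Multiset (List V)) (M : Multiset (List V × List V)),
      D = N + M.map (through a) ∧ ∀ l ∈ N, a ∉ l := by
  induction D using Multiset.induction_on with
  | empty => exact ⟨0, 0, by simp⟩
  | cons l D ih =>
    obtain ⟨N, M, rfl, hN⟩ := ih
    by_cases hl : a ∈ l
    · obtain ⟨pq, rfl⟩ := exists_eq_through hl
      exact ⟨N, pq ::ₘ M, by simp, hN⟩
    · exact ⟨l ::ₘ N, M, by simp, Multiset.forall_mem_cons.mpr ⟨hl, hN⟩⟩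

lemma nodup_through_congr {p q p' q' : List V} (hp : p.Perm p') (hq : q.Perm q') :
    (through a (p, q)).Nodup ↔ (through a (p', q')).Nodup := by
  rw [(through_perm a _).nodup_iff, (through_perm a _).nodup_iff]
  exact ((hp.append hq).cons a).nodup_iff

lemma exists_reverse_leg {M : Multiset (List V × List V)} {l : List V} {R : Multiset (List V)}
    (hM : ∀ pq ∈ M, (through a pq).Nodup) (h : M.bind legs = l ::ₘ R) :
    ∃ M' : Multiset (List V × List V),
      (∀ pq ∈ M', (through a pq).Nodup) ∧ M'.bind legs = l.reverse ::ₘ R := by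
  have hl : l ∈ M.bind legs := h ▸ Multiset.mem_cons_self l R
  obtain ⟨⟨p, q⟩, hpq, hlpq⟩ := Multiset.mem_bind.mp hl
  obtain ⟨M₀, rfl⟩ := Multiset.exists_cons_of_mem hpq
  rw [Multiset.forall_mem_cons] at hM
  obtain rfl | rfl : l = p ∨ l = q := by simpa only [legs, Multiset.insert_eq_cons,
    Multiset.mem_cons, Multiset.mem_singleton] using hlpq
  · refine ⟨(l.reverse, q) ::ₘ M₀, Multiset.forall_mem_cons.mpr ⟨?_, hM.2⟩, ?_⟩
    · exact (nodup_through_congr l.reverse_perm (.refl q)).mpr hM.1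
    · have hR : q ::ₘ M₀.bind legs = R := by simpa [legs] using h
      simp [legs, ← hR]
  · refine ⟨(p, l.reverse) ::ₘ M₀, Multiset.forall_mem_cons.mpr ⟨?_, hM.2⟩, ?_⟩
    · exact (nodup_through_congr (.refl p) l.reverse_perm).mpr hM.1
    · have hR : p ::ₘ M₀.bind legs = R := by simpa [legs, Multiset.cons_swap p l] using h
      simp [legs, ← hR, Multiset.cons_swap p l.reverse]

end Through

section AddEdge

variable {a : V}

lemma exists_shift {M : Multiset (List V × List V)} {l : List V} {R : Multiset (List V)} {x z : V}
    (hM : ∀ pq ∈ M, (through a pq).Nodup) (h : M.bind legs = l ::ₘ R)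
    (hz : z ∈ head l) (hx : x ∈ last l) :
    ∃ M' : Multiset (List V × List V),
      (∀ pq ∈ M', (through a pq).Nodup) ∧ M'.bind legs = l.reverse ::ₘ R ∧
      s(a, z) ::ₘ (M'.map (through a)).bind edges = s(a, x) ::ₘ (M.map (through a)).bind edges ∧
      x ::ₘ (M'.map (through a)).bind ends = z ::ₘ (M.map (through a)).bind ends := by
  obtain ⟨M', hM', h'⟩ := exists_reverse_leg hM h
  have hne : l ≠ [] := List.ne_nil_of_mem (mem_of_mem_head hz)
  have hne' : l.reverse ≠ [] := List.reverse_ne_nil_iff.mpr hne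
  have hhead := head_eq_of_mem hz
  have hlast := last_eq_of_mem hx
  refine ⟨M', hM', h', ?_, ?_⟩
  · simp [bind_edges_map_through, h, h', edges_cons, hhead, hlast, Multiset.cons_swap]
  · simp [bind_ends_map_through, h, h', last_cons_eq_last, hne, hne', hhead, hlast,
      Multiset.cons_swap]

/-- The invariant: `s(a, x)` has been added and `x` has not lost an end of a path yet. If a leg `l`
ends at `x`, reversing it makes `s(a, x)` its edge at `a` and expels the edge from `a` to the first
vertex of `l`. The reversed leg joins `F` and is never touched again. -/
lemma exists_reroute {S : Set V} {R : Multiset (List V)} :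
    ∀ {M : Multiset (List V × List V)} {F : Multiset (List V)} {x : V},
      (∀ pq ∈ M, (through a pq).Nodup) → M.bind legs = R + F → (x ::ₘ R.bind head).Nodup →
      (∀ v ∈ x ::ₘ R.bind head, v ∈ S ∨ v ∈ R.bind last) →
      ∃ M' : Multiset (List V × List V), ∃ y ∈ S, (∀ pq ∈ M', (through a pq).Nodup) ∧
        s(a, y) ::ₘ (M'.map (through a)).bind edges =
          s(a, x) ::ₘ (M.map (through a)).bind edges ∧
        x ::ₘ (M'.map (through a)).bind ends = y ::ₘ (M.map (through a)).bind ends := by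
  induction R using Multiset.strongInductionOn with
  | ih R ih =>
    intro M F x hM hlegs hnodup hfree
    by_cases hx : x ∈ S
    · exact ⟨M, x, hx, hM, rfl, rfl⟩
    have hxR := (hfree x (Multiset.mem_cons_self _ _)).resolve_left hx
    obtain ⟨l, hl, hxl⟩ := Multiset.mem_bind.mp hxR
    obtain ⟨R, rfl⟩ := Multiset.exists_cons_of_mem hl
    obtain ⟨z, hz⟩ := exists_mem_head_of_mem_last hxl
    obtain ⟨M₁, hM₁, hlegs₁, hedges₁, hends₁⟩ := exists_shift hM (hlegs.trans
      (Multiset.cons_add _ _ _)) hz hxl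
    rw [Multiset.cons_bind, head_eq_of_mem hz, Multiset.singleton_add, Multiset.nodup_cons]
      at hnodup
    have hfree' : ∀ v ∈ z ::ₘ R.bind head, v ∈ S ∨ v ∈ R.bind last := fun v hv => by
      have hvx : v ≠ x := fun h => hnodup.1 (h ▸ hv)
      simpa [last_eq_of_mem hxl, hvx] using hfree v (by simpa [head_eq_of_mem hz, hvx] using hv)
    obtain ⟨M', y, hy, hM', hedges, hends⟩ :=
      ih R (Multiset.lt_cons_self R l) hM₁ (hlegs₁.trans (Multiset.add_cons _ _ _).symm) hnodup.2
        hfree'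
    refine ⟨M', y, hy, hM', hedges.trans hedges₁, (Multiset.cons_inj_right z).mp ?_⟩
    rw [Multiset.cons_swap, hends, Multiset.cons_swap, hends₁, Multiset.cons_swap]

lemma exists_cons_of_mem_ends {l : List V} {y : V} (h : y ∈ ends l) :
    ∃ t : List V, (y :: t).Perm l ∧ edges (y :: t) = edges l ∧ ends (y :: t) = ends l := by
  obtain h | h := Multiset.mem_add.mp h
  · obtain ⟨t, rfl⟩ := eq_cons_of_mem_head h
    exact ⟨t, .refl _, rfl, rfl⟩
  · rw [← head_reverse] at h
    obtain ⟨t, ht⟩ := eq_cons_of_mem_head h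
    exact ⟨t, ht ▸ l.reverse_perm, ht ▸ edges_reverse l, ht ▸ ends_reverse l⟩

lemma exists_extend {l : List V} {y : V} (hl : l.Nodup) (ha : a ∉ l) (hy : y ∈ ends l) :
    ∃ l' : List V, l' ≠ [] ∧ l'.Nodup ∧ edges l' = s(a, y) ::ₘ edges l ∧
      y ::ₘ ends l' = a ::ₘ ends l := by
  obtain ⟨t, hperm, hedges, hends⟩ := exists_cons_of_mem_ends hy
  refine ⟨a :: y :: t, List.cons_ne_nil _ _, List.nodup_cons.mpr
    ⟨hperm.mem_iff.not.mpr ha, hperm.nodup_iff.mpr hl⟩, ?_, ?_⟩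
  · simp [← hedges, edges_cons]
  · rw [← hends]
    simp [ends, last_cons_eq_last, Multiset.cons_swap]

lemma nodup_heads {M : Multiset (List V × List V)} {x : V}
    (h : (s(a, x) ::ₘ (M.map (through a)).bind edges).Nodup) :
    (x ::ₘ (M.bind legs).bind head).Nodup := by
  refine Multiset.Nodup.of_map (s(a, ·)) (Multiset.nodup_of_le ?_ h)
  rw [Multiset.map_cons, bind_edges_map_through]
  simp only [edges_cons, Multiset.bind_add, Multiset.map_bind]
  exact Multiset.cons_le_cons _ (Multiset.le_add_right _ _)

lemma ne_of_mem_heads {M : Multiset (List V × List V)} {v : V}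
    (hM : ∀ pq ∈ M, (through a pq).Nodup) (h : v ∈ (M.bind legs).bind head) : v ≠ a := by
  simp only [Multiset.mem_bind] at h
  obtain ⟨l, ⟨pq, hpq, hl⟩, hv⟩ := h
  rintro rfl
  exact notMem_of_mem_legs (hM pq hpq) hl (mem_of_mem_head hv)

lemma mem_lasts_of_mem_ends {M : Multiset (List V × List V)} {v : V} (hva : v ≠ a)
    (h : v ∈ (M.map (through a)).bind ends) : v ∈ (M.bind legs).bind last := by
  rw [bind_ends_map_through] at h
  obtain ⟨l, hl, hv⟩ := Multiset.mem_bind.mp h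
  exact Multiset.mem_bind.mpr ⟨l, hl, mem_last_of_mem_last_cons hva hv⟩

/-- Lovász's lemma. -/
theorem IsPathPartition.exists_add_edge {D : Multiset (List V)} {E : Multiset (Sym2 V)} {x : V}
    (hD : IsPathPartition D E) (hxa : x ≠ a) (hE : (s(a, x) ::ₘ E).Nodup)
    (hends : ∀ v, v ≠ a → v ∈ D.bind ends) :
    ∃ D', IsPathPartition D' (s(a, x) ::ₘ E) ∧ x ::ₘ D'.bind ends = a ::ₘ D.bind ends := by
  obtain ⟨hne, hnodup, rfl⟩ := hD
  obtain ⟨N, M, rfl, haN⟩ := exists_eq_add_map_through a D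
  simp only [Multiset.add_bind, Multiset.mem_add, or_imp, forall_and, Multiset.mem_map,
    forall_exists_index, and_imp, forall_apply_eq_imp_iff₂] at hE hends hne hnodup ⊢
  have hheads : (x ::ₘ (M.bind legs).bind head).Nodup :=
    nodup_heads (Multiset.nodup_of_le (Multiset.cons_le_cons _ (Multiset.le_add_left _ _)) hE)
  have hfree : ∀ v ∈ x ::ₘ (M.bind legs).bind head,
      v ∈ {v | v ∈ N.bind ends} ∨ v ∈ (M.bind legs).bind last := by
    intro v hv
    have hva : v ≠ a := (Multiset.mem_cons.mp hv).elim (· ▸ hxa) (ne_of_mem_heads hnodup.2)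
    exact (hends v hva).imp_right (mem_lasts_of_mem_ends hva)
  obtain ⟨M', y, hy, hM', hedges, hends'⟩ :=
    exists_reroute hnodup.2 (add_zero _).symm hheads hfree
  obtain ⟨l, hl, hyl⟩ := Multiset.mem_bind.mp hy
  obtain ⟨N, rfl⟩ := Multiset.exists_cons_of_mem hl
  obtain ⟨l', hne', hnodup', hedges', hends''⟩ :=
    exists_extend (hnodup.1 l hl) (haN l hl) hyl
  refine ⟨l' ::ₘ N + M'.map (through a), ⟨?_, ?_, ?_⟩, (Multiset.cons_inj_right y).mp ?_⟩
  · simp only [Multiset.mem_add, Multiset.mem_cons, Multiset.mem_map]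
    rintro _ ((rfl | h) | ⟨pq, -, rfl⟩)
    exacts [hne', hne.1 _ (Multiset.mem_cons_of_mem h), by simp [through]]
  · simp only [Multiset.mem_add, Multiset.mem_cons, Multiset.mem_map]
    rintro _ ((rfl | h) | ⟨pq, hpq, rfl⟩)
    exacts [hnodup', hnodup.1 _ (Multiset.mem_cons_of_mem h), hM' pq hpq]
  · rw [Multiset.add_bind, Multiset.cons_bind, Multiset.cons_bind, hedges', Multiset.cons_add,
      Multiset.cons_add, ← Multiset.add_cons, hedges, Multiset.add_cons]
  · calc y ::ₘ x ::ₘ (l' ::ₘ N + M'.map (through a)).bind ends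
        = (y ::ₘ ends l') + N.bind ends + (x ::ₘ (M'.map (through a)).bind ends) := by
          simp [add_assoc, Multiset.cons_swap x]
      _ = (a ::ₘ ends l) + N.bind ends + (y ::ₘ (M.map (through a)).bind ends) := by
          rw [hends'', hends']
      _ = y ::ₘ a ::ₘ ((l ::ₘ N).bind ends + (M.map (through a)).bind ends) := by
          simp [add_assoc]

end AddEdge

section Partitionable

variable [Fintype V] {E : Multiset (Sym2 V)}

/-- `E` splits into paths of which every vertex is an end twice, except that the ends in `T` are
missing. -/
def IsPartitionable (E : Multiset (Sym2 V)) (T : Multiset V) : Prop :=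
  ∃ D, IsPathPartition D E ∧ T + D.bind ends = 2 • Finset.univ.val

lemma isPartitionable_zero : IsPartitionable (0 : Multiset (Sym2 V)) 0 := by
  refine ⟨Finset.univ.val.map fun v => [v], ⟨by simp, by simp, ?_⟩, ?_⟩
  · simp [Multiset.bind_map, edges_cons]
  · have hbind : Finset.univ.val.bind singleton = (Finset.univ.val : Multiset V) :=
      (Multiset.bind_singleton _ id).trans (Multiset.map_id _)
    simp [Multiset.bind_map, ends, last, two_nsmul, hbind]

lemma IsPartitionable.cons {a x : V} (h : IsPartitionable E {a, x}) (hax : a ≠ x) :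
    IsPartitionable (s(a, x) ::ₘ E) 0 := by
  obtain ⟨D, ⟨hne, hnodup, rfl⟩, hends⟩ := h
  refine ⟨[a, x] ::ₘ D, ⟨?_, ?_, ?_⟩, ?_⟩
  · exact Multiset.forall_mem_cons.mpr ⟨by simp, hne⟩
  · exact Multiset.forall_mem_cons.mpr ⟨by simp [hax], hnodup⟩
  · simp [edges_cons]
  · rw [← hends, zero_add, Multiset.cons_bind]
    rfl

lemma IsPartitionable.cons_of_ne {t u w : V} (h : IsPartitionable E {w, u}) (htw : t ≠ w)
    (hE : (s(w, t) ::ₘ E).Nodup) : IsPartitionable (s(w, t) ::ₘ E) {t, u} := by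
  classical
  obtain ⟨D, hD, hends⟩ := h
  have hmem : ∀ v, v ≠ w → v ∈ D.bind ends := by
    intro v hvw
    have hcount := congr_arg (Multiset.count v) hends
    rw [Multiset.insert_eq_cons, Multiset.cons_add, Multiset.count_cons_of_ne hvw,
      Multiset.singleton_add, Multiset.count_cons, Multiset.count_nsmul,
      Multiset.count_univ] at hcount
    refine Multiset.count_pos.mp ?_
    split_ifs at hcount <;> omega
  obtain ⟨D', hD', hends'⟩ := hD.exists_add_edge htw hE hmem
  refine ⟨D', hD', ?_⟩
  rw [← hends]
  simp only [Multiset.insert_eq_cons, Multiset.cons_add, Multiset.singleton_add]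
  rw [Multiset.cons_swap, hends', Multiset.cons_swap]

lemma IsPartitionable.of_isolated {t : V} (h : IsPartitionable E 0) (ht : ∀ e ∈ E, t ∉ e) :
    IsPartitionable E {t, t} := by
  obtain ⟨D, ⟨hne, hnodup, rfl⟩, hends⟩ := h
  have htD : t ∈ D.bind ends := by
    rw [← zero_add (D.bind ends), hends]
    simp
  obtain ⟨l, hl, htl⟩ := Multiset.mem_bind.mp htD
  obtain ⟨q, hperm, hedges, -⟩ := exists_cons_of_mem_ends htl
  obtain ⟨D, rfl⟩ := Multiset.exists_cons_of_mem hl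
  obtain rfl : l = [t] := by
    cases q with
    | nil => exact List.perm_singleton.mp hperm.symm
    | cons u q =>
      refine absurd (Sym2.mem_mk_left t u) (ht s(t, u) (Multiset.mem_bind.mpr ⟨l, hl, ?_⟩))
      simp [← hedges, edges_cons]
  refine ⟨D, ⟨fun l h => hne l (Multiset.mem_cons_of_mem h),
    fun l h => hnodup l (Multiset.mem_cons_of_mem h), by simp [edges_cons]⟩, ?_⟩
  rw [← hends, zero_add, Multiset.cons_bind]
  rfl

end Partitionable

section Parity

variable [DecidableEq V] {E : Multiset (Sym2 V)} {v : V}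

/-- The number of edges in `E` that are incident with `v`. -/
def degree (E : Multiset (Sym2 V)) (v : V) : ℕ := E.countP (v ∈ ·)

lemma odd_degree_cons {a x : V} :
    Odd (degree (s(a, x) ::ₘ E) v) ↔ ¬(Odd (degree E v) ↔ v = a ∨ v = x) := by
  simp only [degree, Multiset.countP_cons, Sym2.mem_iff]
  split_ifs with h <;> simp [h, Nat.odd_add_one]

lemma exists_mem_of_odd_degree (h : Odd (degree E v)) : ∃ e ∈ E, v ∈ e :=
  Multiset.countP_pos.mp h.pos

theorem isPartitionable_of_parity [Fintype V] {E : Multiset (Sym2 V)} (hE : E.Nodup)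
    (hdiag : ∀ e ∈ E, ¬e.IsDiag) :
    ((∀ v, ¬Odd (degree E v)) → IsPartitionable E 0) ∧
      ∀ t u, t ≠ u → (∀ v, Odd (degree E v) ↔ v = t ∨ v = u) → IsPartitionable E {t, u} := by
  induction E using Multiset.strongInductionOn with
  | ih E ih =>
    have ih' {a x E'} (h : E = s(a, x) ::ₘ E') := ih E' (h ▸ Multiset.lt_cons_self _ _)
      (Multiset.nodup_cons.mp (h ▸ hE)).2 fun e he => hdiag e (h ▸ Multiset.mem_cons_of_mem he)
    refine ⟨fun heven => ?_, fun t u htu hodd => ?_⟩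
    · obtain rfl | ⟨e, he⟩ := E.empty_or_exists_mem
      · exact isPartitionable_zero
      obtain ⟨E', rfl⟩ := Multiset.exists_cons_of_mem he
      induction e with | _ a x
      have hax : a ≠ x := hdiag _ he
      refine ((ih' rfl).2 a x hax fun v => ?_).cons hax
      simpa only [odd_degree_cons, not_not] using heven v
    -- A neighbour `w ≠ u` of `t` takes over the role of `t` once `s(w, t)` is removed.
    by_cases hw : ∃ w, w ≠ u ∧ s(w, t) ∈ E
    · obtain ⟨w, hwu, hw⟩ := hw
      obtain ⟨E', rfl⟩ := Multiset.exists_cons_of_mem hw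
      have hwt : w ≠ t := hdiag _ hw
      refine ((ih' rfl).2 w u hwu fun v => ?_).cons_of_ne hwt.symm hE
      have := odd_degree_cons.symm.trans (hodd v)
      grind
    · have hpendant : ∀ e ∈ E, t ∈ e → e = s(t, u) := by
        rintro e he ⟨w, rfl⟩
        by_contra! hne
        exact hw ⟨w, fun h => hne (h ▸ rfl), Sym2.eq_swap ▸ he⟩
      obtain ⟨e, he, hte⟩ := exists_mem_of_odd_degree ((hodd t).mpr (.inl rfl))
      obtain rfl := hpendant e he hte
      obtain ⟨E', rfl⟩ := Multiset.exists_cons_of_mem he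
      have hisolated : ∀ e ∈ E', t ∉ e := fun e he' hte =>
        (Multiset.nodup_cons.mp hE).1 (hpendant e (Multiset.mem_cons_of_mem he') hte ▸ he')
      have heven : ∀ v, ¬Odd (degree E' v) := fun v => by
        have := odd_degree_cons.symm.trans (hodd v)
        tauto
      rw [Multiset.pair_comm]
      exact (((ih' rfl).1 heven).of_isolated hisolated).cons_of_ne htu.symm hE

end Parity

section Orientation

lemma sum_count_le_card [DecidableEq V] (s : Multiset V) (S : Finset V) :
    ∑ v ∈ S, s.count v ≤ s.card :=
  (Finset.sum_le_sum_of_subset Finset.subset_union_left).trans_eq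
    (Multiset.sum_count_eq_card fun _ hv =>
      Finset.mem_union_right S (Multiset.mem_toFinset.mpr hv))

lemma exists_injective_mem {ι : Type*} [Fintype ι] [DecidableEq V] {k : ℕ} (hk : 0 < k)
    (e : ι → Multiset V) (hcard : ∀ i, (e i).card ≤ k) (hcount : ∀ v, k ≤ (∑ i, e i).count v) :
    ∃ f : V → ι, f.Injective ∧ ∀ v, v ∈ e (f v) := by
  classical
  refine (Fintype.all_card_le_filter_rel_iff_exists_injective fun v i => v ∈ e i).mp fun S => ?_
  refine Nat.le_of_mul_le_mul_right ?_ hk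
  set I := Finset.univ.filter fun i => ∃ v ∈ S, v ∈ e i
  calc S.card * k ≤ ∑ v ∈ S, (∑ i, e i).count v := by
        simpa using Finset.card_nsmul_le_sum S _ k fun v _ => hcount v
    _ = ∑ i, ∑ v ∈ S, (e i).count v := by
        simp only [Multiset.count_sum']
        exact Finset.sum_comm
    _ = ∑ i ∈ I, ∑ v ∈ S, (e i).count v := by
        refine (Finset.sum_filter_of_ne fun i _ hi => ?_).symm
        obtain ⟨v, hv, hvi⟩ := Finset.exists_ne_zero_of_sum_ne_zero hi
        exact ⟨v, hv, Multiset.count_ne_zero.mp hvi⟩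
    _ ≤ I.card * k := by
        simpa using Finset.sum_le_card_nsmul I _ k fun i _ =>
          (sum_count_le_card (e i) S).trans (hcard i)

lemma card_ends {l : List V} (h : l ≠ []) : (ends l).card = 2 := by
  obtain ⟨a, l, rfl⟩ := List.exists_cons_of_ne_nil h
  simp [ends, last, List.getLast?_cons]

lemma card_bind_ends {D : Multiset (List V)} (hD : ∀ l ∈ D, l ≠ []) :
    (D.bind ends).card = 2 * D.card := by
  have hmap : D.map (Multiset.card ∘ ends) = D.map fun _ => 2 :=
    Multiset.map_congr rfl fun l hl => card_ends (hD l hl)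
  rw [Multiset.card_bind, hmap]
  simp [mul_comm]

lemma exists_reorient {l : List V} {v : V} (h : v ∈ ends l) (hl : l.Nodup) :
    ∃ (p : List V) (u : V), p.Nodup ∧ edges p = edges l ∧ ends p = ends l ∧ head p = {v} ∧
      last p = {u} := by
  obtain ⟨t, hperm, hedges, hends⟩ := exists_cons_of_mem_ends h
  exact ⟨v :: t, (v :: t).getLast (List.cons_ne_nil v t), hperm.nodup_iff.mpr hl, hedges, hends,
    rfl, by simp [last, List.getLast?_eq_getLast_of_ne_nil]⟩

/-- The edges `E` split into paths `P v`, one for every vertex `v`, such that `P v` starts at `v`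
and ends at `σ v`. -/
structure IsPermPartition [Fintype V] (P : V → List V) (σ : Equiv.Perm V)
    (E : Multiset (Sym2 V)) : Prop where
  nodup : ∀ v, (P v).Nodup
  head_eq : ∀ v, head (P v) = {v}
  last_eq : ∀ v, last (P v) = {σ v}
  sum_edges : ∑ v, edges (P v) = E

theorem IsPartitionable.exists_isPermPartition [Fintype V] {E : Multiset (Sym2 V)}
    (h : IsPartitionable E 0) : ∃ P σ, IsPermPartition P σ E := by
  classical
  obtain ⟨D, ⟨hne, hnodup, hDE⟩, hends⟩ := h
  have hcard : D.card = Fintype.card V := by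
    have := congr_arg Multiset.card hends
    rw [zero_add, card_bind_ends hne, Multiset.card_nsmul] at this
    exact Nat.eq_of_mul_eq_mul_left two_pos this
  obtain ⟨ι, _, g, rfl⟩ : ∃ (ι : Type _) (_ : Fintype ι) (g : ι → List V),
    Finset.univ.val.map g = D := ⟨D, inferInstance, (↑), D.map_univ_coe⟩
  rw [Multiset.bind_map] at hDE hends
  replace hends : ∑ i, ends (g i) = 2 • Finset.univ.val := (zero_add _).symm.trans hends
  have hg (i : ι) : g i ∈ Finset.univ.val.map g := Multiset.mem_map_of_mem g (Finset.mem_univ i)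
  obtain ⟨f, hf, hmem⟩ := exists_injective_mem two_pos (fun i => ends (g i))
    (fun i => (card_ends (hne _ (hg i))).le) fun v => by
      rw [hends, Multiset.count_nsmul, Multiset.count_univ, mul_one]
  have hf' : f.Bijective :=
    (Fintype.bijective_iff_injective_and_card f).mpr ⟨hf, by simpa using hcard.symm⟩
  choose P σ hP hedges hPends hhead hlast using fun v => exists_reorient (hmem v) (hnodup _ (hg _))
  have hσ : ∑ v, {σ v} = (Finset.univ.val : Multiset V) := by
    have hsum := (Finset.sum_congr rfl fun v _ => hPends v).trans
      ((hf'.sum_comp fun i => ends (g i)).trans hends)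
    simp only [ends, hhead, hlast, Finset.sum_add_distrib, Finset.sum_multiset_singleton,
      two_nsmul] at hsum
    exact add_left_cancel hsum
  have hsurj : σ.Surjective := fun u => by
    have hu : u ∈ ∑ v, ({σ v} : Multiset V) := hσ ▸ Finset.mem_univ u
    simpa [Multiset.mem_sum, eq_comm] using hu
  refine ⟨P, .ofBijective σ (Finite.surjective_iff_bijective.mp hsurj), hP, hhead, hlast, ?_⟩
  exact (Finset.sum_congr rfl fun v _ => hedges v).trans
    ((hf'.sum_comp fun i => edges (g i)).trans hDE)

end Orientation

section Layered

variable {P : V → List V} {σ : V → V}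

/-- The path that runs through one layer `{i} × V` after the other for the entries `i` of a list:
if it enters a layer at `v`, it follows the copy of `P v` and moves on to the next layer at
`σ v`. -/
def layered (P : V → List V) (σ : V → V) : List A → V → List (A × V)
  | [], _ => []
  | i :: l, v => (P v).map (Prod.mk i) ++ layered P σ l (σ v)

lemma fst_mem_of_mem_layered {x : A × V} {l : List A} {v : V} (hx : x ∈ layered P σ l v) :
    x.1 ∈ l := by
  induction l generalizing v with
  | nil => simp [layered] at hx
  | cons i l ih =>
    obtain hx | hx := List.mem_append.mp hx
    · obtain ⟨u, -, rfl⟩ := List.mem_map.mp hx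
      exact List.mem_cons_self
    · exact List.mem_cons_of_mem i (ih hx)

lemma nodup_layered (hP : ∀ v, (P v).Nodup) {l : List A} (hl : l.Nodup) (v : V) :
    (layered P σ l v).Nodup := by
  induction l generalizing v with
  | nil => exact List.nodup_nil
  | cons i l ih =>
    obtain ⟨hil, hl⟩ := List.nodup_cons.mp hl
    refine ((hP v).map (Prod.mk_right_injective i)).append (ih hl _) fun x hx hx' => ?_
    obtain ⟨u, -, rfl⟩ := List.mem_map.mp hx
    exact hil (fst_mem_of_mem_layered hx')

lemma head_layered (hP : ∀ v, head (P v) = {v}) (l : List A) (v : V) :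
    head (layered P σ l v) = (head l).map (·, v) := by
  cases l with
  | nil => rfl
  | cons i l =>
    obtain ⟨t, ht⟩ := eq_cons_of_mem_head (v := v) (l := P v) (by simp [hP])
    simp [layered, ht]

lemma edges_layered_cons (hhead : ∀ v, head (P v) = {v}) (hlast : ∀ v, last (P v) = {σ v})
    (i : A) (l : List A) (v : V) :
    edges (layered P σ (i :: l) v) = (edges (P v)).map (Sym2.map (Prod.mk i)) +
      ((head l).map (s(i, ·))).map (Sym2.map (·, σ v)) + edges (layered P σ l (σ v)) := by
  rw [layered, edges_append, edges_map, last_map, hlast, head_layered hhead]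
  simp [Function.comp_def]

lemma sum_edges_layered [Fintype V] {σ : Equiv.Perm V} {E : Multiset (Sym2 V)}
    (h : IsPermPartition P σ E) (l : List A) :
    ∑ v, edges (layered P σ l v) =
      (l.map fun i => E.map (Sym2.map (Prod.mk i))).sum +
        ∑ v, (edges l).map (Sym2.map (·, v)) := by
  induction l with
  | nil => simp [layered]
  | cons i l ih =>
    simp only [edges_layered_cons h.head_eq h.last_eq, Finset.sum_add_distrib]
    rw [Equiv.sum_comp σ fun u => ((head l).map (s(i, ·))).map (Sym2.map (·, u)),
      Equiv.sum_comp σ fun u => edges (layered P σ l u), ih, edges_cons]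
    have hsum : ∑ v, (edges (P v)).map (Sym2.map (Prod.mk i)) = E.map (Sym2.map (Prod.mk i)) := by
      rw [← h.sum_edges]
      simp only [← Multiset.coe_mapAddMonoidHom, map_sum]
    simp only [hsum, List.map_cons, List.sum_cons, Multiset.map_add, Finset.sum_add_distrib]
    abel

end Layered

section BoxProd

variable {W : Type*}

lemma nodup_sum_map_sym2 {ι : Type*} [Fintype ι] {f : ι → V → W} (hf : Function.Injective2 f)
    {E : Multiset (Sym2 V)} (hE : E.Nodup) : (∑ i, E.map (Sym2.map (f i))).Nodup := by
  refine Multiset.nodup_bind.mpr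
    ⟨fun i _ => hE.map (Sym2.map.injective (hf.right i)),
      Multiset.Nodup.pairwise (fun i _ j _ hij => ?_) Finset.univ.nodup⟩
  refine Multiset.disjoint_left.mpr fun {e} hi hj => hij ?_
  obtain ⟨⟨u, u'⟩, -, rfl⟩ := Multiset.mem_map.mp hi
  obtain ⟨⟨w, w'⟩, -, h⟩ := Multiset.mem_map.mp hj
  have hmem : f i u ∈ s(f j w, f j w') :=
    (show s(f j w, f j w') = s(f i u, f i u') from h) ▸ Sym2.mem_mk_left _ _
  obtain h | h := Sym2.mem_iff.mp hmem
  exacts [(hf h).1, (hf h).1]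

open scoped SimpleGraph in
lemma edgeFinset_val_boxProd [Fintype V] [Fintype A] (G : SimpleGraph A) (H : SimpleGraph V)
    [Fintype G.edgeSet] [Fintype H.edgeSet] [Fintype (G □ H).edgeSet] :
    (G □ H).edgeFinset.val = (∑ i, H.edgeFinset.val.map (Sym2.map (Prod.mk i))) +
      ∑ v, G.edgeFinset.val.map (Sym2.map (·, v)) := by
  have hdisj : Disjoint (∑ i, H.edgeFinset.val.map (Sym2.map (Prod.mk i)))
      (∑ v, G.edgeFinset.val.map (Sym2.map (·, v))) := by
    refine Multiset.disjoint_left.mpr fun {e} hH hG => ?_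
    simp only [Multiset.mem_sum, Multiset.mem_map, Finset.mem_val,
      SimpleGraph.mem_edgeFinset] at hH hG
    obtain ⟨i, -, ⟨u, u'⟩, -, rfl⟩ := hH
    obtain ⟨v, -, ⟨j, j'⟩, hjj', h⟩ := hG
    refine G.ne_of_adj hjj' ?_
    have hfst : s(j, j') = s(i, i) := congr_arg (Sym2.map Prod.fst) h
    grind
  refine Multiset.Nodup.ext (Finset.nodup _) (Multiset.nodup_add.mpr
    ⟨nodup_sum_map_sym2 (fun _ _ _ _ h => Prod.mk.inj h) H.edgeFinset.nodup,
    nodup_sum_map_sym2 (fun _ _ _ _ h => (Prod.mk.inj h).symm) G.edgeFinset.nodup, hdisj⟩) |>.mpr ?_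
  rintro ⟨⟨i, u⟩, ⟨j, v⟩⟩
  simp only [Finset.mem_val, SimpleGraph.mem_edgeFinset, SimpleGraph.mem_edgeSet,
    SimpleGraph.boxProd_adj, Multiset.mem_add, Multiset.mem_sum, Finset.mem_univ,
    Multiset.mem_map, Sym2.exists, Sym2.map_mk, Sym2.eq_iff, Prod.mk.injEq, true_and]
  grind [SimpleGraph.adj_comm]

end BoxProd

section Degree

lemma nodup_edges {l : List V} (hl : l.Nodup) : (edges l).Nodup := by
  induction l with
  | nil => exact Multiset.nodup_zero
  | cons a l ih =>
    obtain ⟨hal, hl⟩ := List.nodup_cons.mp hl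
    cases l with
    | nil => simp [edges_cons]
    | cons b l =>
      rw [edges_cons, head_cons, Multiset.map_singleton, Multiset.singleton_add,
        Multiset.nodup_cons]
      exact ⟨fun h => hal (mem_of_mem_edges h (Sym2.mem_mk_left a b)), ih hl⟩

variable [DecidableEq V]

lemma degree_edgeFinset (G : SimpleGraph V) [Fintype G.edgeSet] (v : V)
    [Fintype (G.neighborSet v)] : degree G.edgeFinset.val v = G.degree v := by
  rw [← G.card_incidenceFinset_eq_degree, G.incidenceFinset_eq_filter, degree,
    Multiset.countP_eq_card_filter]
  rfl

lemma even_degree_edges_add_count_ends {l : List V} (hl : l.Nodup) (v : V) :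
    Even (degree (edges l) v + (ends l).count v) := by
  induction l with
  | nil => simp [degree, ends]
  | cons a l ih =>
    cases l with
    | nil => by_cases hv : v = a <;> simp [degree, ends, last, edges_cons, hv]
    | cons b l =>
      specialize ih hl.of_cons
      have hab : a ≠ b := fun h => by simp [h] at hl
      rw [edges_cons, ends, last_cons_eq_last (List.cons_ne_nil b l)]
      rw [ends] at ih
      simp only [degree, head_cons, Multiset.map_singleton, Multiset.singleton_add,
        Multiset.countP_cons, Multiset.count_cons, Sym2.mem_iff] at ih ⊢
      grind

lemma even_degree_bind_edges_add_count_bind_ends {D : Multiset (List V)}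
    (hD : ∀ l ∈ D, l.Nodup) (v : V) :
    Even (degree (D.bind edges) v + (D.bind ends).count v) := by
  induction D using Multiset.induction_on with
  | empty => simp [degree]
  | cons l D ih =>
    rw [Multiset.forall_mem_cons] at hD
    have := (even_degree_edges_add_count_ends hD.1 v).add (ih hD.2)
    simp only [degree, Multiset.cons_bind, Multiset.countP_add, Multiset.count_add] at this ⊢
    grind

lemma IsPathPartition.odd_degree_iff {G : SimpleGraph V} [Fintype G.edgeSet]
    {D : Multiset (List V)} (h : IsPathPartition D G.edgeFinset.val) (v : V)
    [Fintype (G.neighborSet v)] :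
    Odd (G.degree v) ↔ Odd ((D.bind ends).count v) := by
  rw [← degree_edgeFinset, ← h.bind_edges]
  exact Nat.even_add'.mp (even_degree_bind_edges_add_count_bind_ends h.nodup v)

end Degree

section OddVertices

open scoped SimpleGraph

lemma IsPathPartition.numOddVertices_le [Fintype V] {G : SimpleGraph V} [Fintype G.edgeSet]
    {D : Multiset (List V)} (h : IsPathPartition D G.edgeFinset.val) :
    G.numOddVertices ≤ 2 * D.card := by
  classical
  rw [← card_bind_ends h.ne_nil]
  refine (Finset.card_le_card fun v hv => ?_).trans (Multiset.toFinset_card_le (D.bind ends))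
  have hodd := (h.odd_degree_iff v).mp (Finset.mem_filter.mp hv).2
  exact Multiset.mem_toFinset.mpr (Multiset.count_pos.mp hodd.pos)

lemma nodup_ends {l : List V} (hl : l.Nodup) (hlen : 2 ≤ l.length) : (ends l).Nodup := by
  obtain ⟨a, b, l, rfl⟩ : ∃ a b t, l = a :: b :: t := by
    match l, hlen with
    | a :: b :: t, _ => exact ⟨a, b, t, rfl⟩
  have hlast : last (a :: b :: l) = {(b :: l).getLast (List.cons_ne_nil b l)} := by
    simp [last, List.getLast?_eq_getLast_of_ne_nil]
  rw [ends, hlast, head_cons, Multiset.singleton_add, Multiset.nodup_cons, Multiset.mem_singleton]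
  refine ⟨fun h => (List.nodup_cons.mp hl).1 ?_, Multiset.nodup_singleton _⟩
  exact h ▸ List.getLast_mem _

lemma numOddVertices_eq_two [Fintype V] {G : SimpleGraph V} [Fintype G.edgeSet] {l : List V}
    (h : IsPathPartition {l} G.edgeFinset.val) (hlen : 2 ≤ l.length) : G.numOddVertices = 2 := by
  classical
  have hl : l.Nodup := h.nodup l (Multiset.mem_singleton_self l)
  have hends := nodup_ends hl hlen
  rw [← card_ends (h.ne_nil l (Multiset.mem_singleton_self l)),
    ← Multiset.toFinset_card_of_nodup hends]
  refine congr_arg Finset.card (Finset.ext fun v => ?_)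
  rw [Finset.mem_filter_univ, Multiset.mem_toFinset, h.odd_degree_iff v, Multiset.singleton_bind,
    Multiset.count_eq_of_nodup hends]
  split_ifs with hv <;> simp [hv]

lemma numOddVertices_boxProd [Fintype V] [Fintype A] (G : SimpleGraph A) (H : SimpleGraph V)
    [DecidableRel H.Adj] (hH : ∀ v, Even (H.degree v)) :
    (G □ H).numOddVertices = G.numOddVertices * Fintype.card V := by
  classical
  rw [SimpleGraph.numOddVertices, SimpleGraph.numOddVertices, ← Finset.card_univ,
    ← Finset.card_product]
  refine congr_arg Finset.card (Finset.ext fun x => ?_)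
  rw [Finset.mem_filter_univ, Finset.mem_product, Finset.mem_filter_univ,
    SimpleGraph.degree_boxProd, Nat.odd_add, iff_true_right (hH x.2)]
  simp only [Finset.mem_univ, and_true]

end OddVertices

section Decomposition

open SimpleGraph

lemma edges_support {G : SimpleGraph V} {u v : V} (w : G.Walk u v) :
    edges w.support = w.edges := by
  rw [Walk.edges_eq_zipWith_support]
  rfl

lemma mem_edges_iff_getElem {l : List V} {e : Sym2 V} :
    e ∈ edges l ↔ ∃ (k : ℕ) (h : k + 1 < l.length), s(l[k], l[k + 1]) = e := by
  rw [edges, Multiset.mem_coe, List.mem_iff_getElem]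
  simp only [List.getElem_zipWith, List.getElem_tail, List.length_zipWith, List.length_tail]
  grind

lemma exists_isPathSubgraph {G : SimpleGraph V} {l : List V} (hne : l ≠ []) (hl : l.Nodup)
    (hG : ∀ e ∈ edges l, e ∈ G.edgeSet) :
    ∃ P : G.Subgraph, P.IsPathSubgraph ∧ ∀ e, e ∈ P.edgeSet ↔ e ∈ edges l := by
  have hchain : l.IsChain G.Adj := List.isChain_iff_getElem.mpr fun k hk =>
    hG _ (mem_edges_iff_getElem.mpr ⟨k, hk, rfl⟩)
  have hsupport := Walk.support_ofSupport hne hchain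
  refine ⟨(Walk.ofSupport l hne hchain).toSubgraph,
    ⟨_, _, _, (Walk.isPath_def _).mpr (by rwa [hsupport]), rfl⟩, fun e => ?_⟩
  rw [Walk.mem_edges_toSubgraph, ← Multiset.mem_coe, ← edges_support, hsupport]

lemma exists_list_of_isPathSubgraph {G : SimpleGraph V} {P : G.Subgraph}
    (hP : P.IsPathSubgraph) :
    ∃ l : List V, l ≠ [] ∧ l.Nodup ∧ ∀ e, e ∈ edges l ↔ e ∈ P.edgeSet := by
  obtain ⟨u, v, w, hw, rfl⟩ := hP
  refine ⟨w.support, w.support_ne_nil, hw.support_nodup, fun e => ?_⟩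
  rw [edges_support, Multiset.mem_coe, Walk.mem_edges_toSubgraph]

variable {G : SimpleGraph V} [Fintype G.edgeSet]

theorem IsPathPartition.pathNumber_le {D : Multiset (List V)}
    (h : IsPathPartition D G.edgeFinset.val) : G.pathNumber ≤ D.card := by
  classical
  have hG : ∀ l ∈ D, ∀ e ∈ edges l, e ∈ G.edgeSet := fun l hl e he =>
    mem_edgeFinset.mp (h.bind_edges ▸ Multiset.mem_bind.mpr ⟨l, hl, he⟩ : e ∈ G.edgeFinset.val)
  have hdisj : ∀ l ∈ D, ∀ l' ∈ D, l ≠ l' → Disjoint (edges l) (edges l') :=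
    have : Std.Symm (Function.onFun Disjoint (edges (V := V))) := ⟨fun _ _ h => h.symm⟩
    (Multiset.nodup_bind.mp (h.bind_edges ▸ G.edgeFinset.nodup)).2.forall
  choose! P hP hPedges using fun l hl =>
    exists_isPathSubgraph (h.ne_nil l hl) (h.nodup l hl) (hG l hl)
  have hdecomp : G.IsPathDecomposition (D.toFinset.image P) := by
    refine ⟨?_, ?_, fun e he => ?_⟩
    · simpa using hP
    · simp only [Finset.forall_mem_image, Multiset.mem_toFinset]
      intro l hl l' hl' hne
      refine Set.disjoint_left.mpr fun e he he' => ?_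
      exact Multiset.disjoint_left.mp (hdisj l hl l' hl' (ne_of_apply_ne P hne))
        ((hPedges l hl e).mp he) ((hPedges l' hl' e).mp he')
    · have hbind : e ∈ D.bind edges := h.bind_edges ▸ mem_edgeFinset.mpr he
      obtain ⟨l, hl, hel⟩ := Multiset.mem_bind.mp hbind
      exact ⟨P l, Finset.mem_image_of_mem P (Multiset.mem_toFinset.mpr hl),
        (hPedges l hl e).mpr hel⟩
  have hle : G.pathNumber ≤ (D.toFinset.image P).card := Nat.sInf_le ⟨_, hdecomp, rfl⟩
  exact hle.trans (Finset.card_image_le.trans D.toFinset_card_le)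

theorem exists_isPathPartition_of_isPathDecomposition {D : Finset G.Subgraph}
    (h : G.IsPathDecomposition D) :
    ∃ D' : Multiset (List V), IsPathPartition D' G.edgeFinset.val ∧ D'.card = D.card := by
  choose! L hne hnodup hedges using fun P hP => exists_list_of_isPathSubgraph (h.isPath P hP)
  refine ⟨D.val.map L, ⟨by simpa using hne, by simpa using hnodup, ?_⟩, Multiset.card_map _ _⟩
  rw [Multiset.bind_map]
  refine (Multiset.Nodup.ext (Multiset.nodup_bind.mpr ⟨fun P hP => nodup_edges (hnodup P hP),
    Multiset.Nodup.pairwise (fun P hP Q hQ hPQ => ?_) D.nodup⟩) G.edgeFinset.nodup).mpr fun e => ?_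
  · refine Multiset.disjoint_left.mpr fun {e} heP heQ => ?_
    exact Set.disjoint_left.mp (h.edgeDisjoint P hP Q hQ hPQ)
      ((hedges P hP e).mp heP) ((hedges Q hQ e).mp heQ)
  · rw [Finset.mem_val, mem_edgeFinset, Multiset.mem_bind]
    refine ⟨fun ⟨P, hP, he⟩ => P.edgeSet_subset ((hedges P hP e).mp he), fun he => ?_⟩
    obtain ⟨P, hP, heP⟩ := h.covers e he
    exact ⟨P, hP, (hedges P hP e).mpr heP⟩

theorem numOddVertices_le_two_mul_pathNumber [Fintype V] (G : SimpleGraph V) :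
    G.numOddVertices ≤ 2 * G.pathNumber := by
  classical
  obtain ⟨D, hD, hDcard⟩ := G.exists_isPathDecomposition_card_eq_pathNumber
  obtain ⟨D', hD', hcard⟩ := exists_isPathPartition_of_isPathDecomposition hD
  exact (hD'.numOddVertices_le).trans_eq (by rw [hcard, hDcard])

end Decomposition

section Construction

open SimpleGraph

lemma isPathPartition_finRange {m : ℕ} (hm : m ≠ 0) [Fintype (pathGraph m).edgeSet] :
    IsPathPartition {List.finRange m} (pathGraph m).edgeFinset.val := by
  refine ⟨by simpa using hm, by simpa using List.nodup_finRange m, ?_⟩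
  rw [Multiset.singleton_bind]
  refine ((nodup_edges (List.nodup_finRange m)).ext (Finset.nodup _)).mpr ?_
  rintro ⟨i, j⟩
  rw [mem_edges_iff_getElem, Finset.mem_val, mem_edgeFinset, mem_edgeSet, pathGraph_adj]
  simp only [List.getElem_finRange, Fin.cast_mk, Sym2.eq_iff, List.length_finRange]
  grind

lemma exists_isPermPartition_of_even [Fintype V] (H : SimpleGraph V) [DecidableRel H.Adj]
    (hH : ∀ v, Even (H.degree v)) : ∃ P σ, IsPermPartition P σ H.edgeFinset.val := by
  classical
  refine ((isPartitionable_of_parity H.edgeFinset.nodup fun e he =>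
    H.not_isDiag_of_mem_edgeFinset he).1 fun v => ?_).exists_isPermPartition
  rw [degree_edgeFinset]
  exact Nat.not_odd_iff_even.mpr (hH v)

theorem exists_isPathPartition_boxProd [Fintype V] {G : SimpleGraph A}
    {H : SimpleGraph V} [DecidableRel H.Adj] [Fintype G.edgeSet] [Fintype (G □ H).edgeSet]
    {l : List A} (hG : IsPathPartition {l} G.edgeFinset.val) (hl : ∀ a, a ∈ l)
    (hH : ∀ v, Even (H.degree v)) :
    ∃ D, IsPathPartition D (G □ H).edgeFinset.val ∧ D.card = Fintype.card V := by
  classical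
  have : Fintype A := ⟨l.toFinset, fun a => List.mem_toFinset.mpr (hl a)⟩
  obtain ⟨P, σ, h⟩ := exists_isPermPartition_of_even H hH
  have hnodup : l.Nodup := hG.nodup l (Multiset.mem_singleton_self l)
  have hne : l ≠ [] := hG.ne_nil l (Multiset.mem_singleton_self l)
  refine ⟨Finset.univ.val.map (layered P σ l), ⟨?_, ?_, ?_⟩, by simp⟩
  · simp only [Multiset.forall_mem_map_iff]
    intro v _ hv
    have hhead := head_layered (σ := σ) h.head_eq l v
    obtain ⟨a, t, rfl⟩ := List.exists_cons_of_ne_nil hne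
    simp [hv] at hhead
  · simpa using nodup_layered h.nodup hnodup
  · have huniv : l.toFinset = Finset.univ := by ext a; simp [hl]
    rw [Multiset.bind_map, edgeFinset_val_boxProd, ← hG.bind_edges, Multiset.singleton_bind,
      ← huniv, List.sum_toFinset _ hnodup]
    exact sum_edges_layered h l

end Construction

end PathDecomposition

theorem theorem5p3 {V : Type*} [Fintype V] (H : SimpleGraph V)
    [DecidableRel H.Adj] (hH : ∀ v : V, Even (H.degree v)) (m : ℕ) (hm : 2 ≤ m) :
    ((SimpleGraph.boxProd (SimpleGraph.pathGraph m) H).pathNumber : ℚ) =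
        ((SimpleGraph.boxProd (SimpleGraph.pathGraph m) H).numOddVertices : ℚ) / 2 ∧
      ((SimpleGraph.boxProd (SimpleGraph.pathGraph m) H).numOddVertices : ℚ) / 2 =
        (Fintype.card V : ℚ) := by
  classical
  have hpath := PathDecomposition.isPathPartition_finRange (m := m) (by omega)
  have hodd : (SimpleGraph.boxProd (SimpleGraph.pathGraph m) H).numOddVertices =
      2 * Fintype.card V := by
    rw [PathDecomposition.numOddVertices_boxProd _ H hH,
      PathDecomposition.numOddVertices_eq_two hpath (by simpa using hm)]
  obtain ⟨D, hD, hcard⟩ :=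
    PathDecomposition.exists_isPathPartition_boxProd hpath List.mem_finRange hH
  have hle := hD.pathNumber_le
  have hge := PathDecomposition.numOddVertices_le_two_mul_pathNumber
    (SimpleGraph.boxProd (SimpleGraph.pathGraph m) H)
  have hnum : (SimpleGraph.boxProd (SimpleGraph.pathGraph m) H).pathNumber = Fintype.card V := by
    omega
  rw [hnum, hodd]
  push_cast
  constructor <;> ring
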